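/- Setting. Let $\xi_1,\dots,\xi_n$ be independent uniform $\pm1$ random variables. A polynomial of degree (at most) $d$ is a real multilinear polynomial $P(x_1,\dots,x_n)=\sum_{S\subseteq[n],\,|S|\le d}a_S\prod_{j\in S}x_j$. Its $i$-th influence is $\mathrm{Inf}_i(P)=\sum_{S\ni i}a_S^2$, and $P$ is called $\tau$-regular if $\max_i \mathrm{Inf}_i(P)\le\tau\sum_{j}\mathrm{Inf}_j(P)$. For $S\subseteq[n]$ and an assignment $\rho\in\{\pm1\}^S$ of the variables in $S$, let $P_\rho$ be the resulting polynomial in $(x_i)_{i\notin S}$, and write $P_\rho=P^*(\rho)+q_\rho$, where $P^*(\rho)$ is the constant term of $P_\rho$. For $C>0$ and $0<\beta<1$, $P_\rho$ is called $(C,\beta)$-tight if $$\sqrt{\mathrm{Var}(q_\rho)}\le |P^*(\rho)|\,\bigl(C\log\tfrac1\beta\bigr)^{-d/2}\quad\text{and}\quad \mathbb P\bigl(|q_\rho|\le\tfrac12|P^*(\rho)|\bigr)\ge 1-\beta,$$ where variance and probability are over $(\xi_i)_{i\notin S}$. A decision tree is a binary tree whose internal nodes are labelled by variables, no variable occurring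 twice on a path from the root, the two edges below a node labelled $x_i$ corresponding to $x_i=\pm1$. Its depth is the length of its longest path from the root. Each leaf corresponds to the assignment $\rho$ of the variables on the path to it and carries the polynomial $P_\rho$ (with $P$ at the root). A random path starts at the root and follows $\xi_1,\dots,\xi_n$. Proposition. There exist absolute constants $C\ge1$ and $C'>0$ such that the following holds. Let $n\ge 0$ and $d\ge1$ be integers, let $P$ be a polynomial of degree at most $d$ in $n$ variables, and let $0<\tau,\beta<\frac13$. Put $$\alpha=C\bigl(d\log\log\tfrac1\beta+d\log d\bigr),\qquad \tau'=\bigl(C'd\log(\max(d,2))\log\tfrac1\tau\bigr)^d\,\tau$$ (thus $\tau'=(C'd\log d\log\frac1\tau)^d\tau$ for $d\ge2$). Let $M\ge 0$ be an integer with $M\frac{\alpha}{\tau}\le n$. Then there is a decision tree of depth at most $M\frac{\alpha}{\tau}$, with $P$ at the root and a polynomial $P_\rho$ of degree at most $d$ at each leaf $\rho$, such that with probability at least $$1-\Bigl(1-\frac1{2C^d}\Bigr)^M$$ a random path from the root reaches a leaf $\rho$ for which $P_\rho$ is $\tau'$-regular or $(C,\beta)$-tight. -/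

import Mathlib

open scoped BigOperators

/-- The Boolean cube `{±1}^n`; `ℤˣ` is the two-element set `{1, -1}`. -/
abbrev Cube (n : ℕ) : Type := Fin n → ℤˣ

/-- Probability of an event under the uniform distribution on `{±1}^n`. -/
noncomputable def cubeProb {n : ℕ} (A : Cube n → Prop) : ℝ :=
  (Nat.card {ξ : Cube n // A ξ} : ℝ) / 2 ^ n

/-- Expectation under the uniform distribution on `{±1}^n`. -/
noncomputable def cubeExp {n : ℕ} (f : Cube n → ℝ) : ℝ :=
  (∑ ξ : Cube n, f ξ) / 2 ^ n

/-- Variance under the uniform distribution on `{±1}^n`. -/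
noncomputable def cubeVar {n : ℕ} (f : Cube n → ℝ) : ℝ :=
  cubeExp (fun ξ => (f ξ - cubeExp f) ^ 2)

/-- A real multilinear polynomial `∑_S a_S ∏_{j ∈ S} x_j` in `n` variables, given by its
coefficients `a_S`, `S ⊆ [n]`. -/
structure MultilinearPoly (n : ℕ) where
  /-- The coefficient of `∏_{j ∈ S} x_j`. -/
  coeff : Finset (Fin n) → ℝ

namespace MultilinearPoly

variable {n : ℕ}

/-- The value of the polynomial at a point of the cube. -/
def eval (P : MultilinearPoly n) (ξ : Cube n) : ℝ :=
  ∑ S : Finset (Fin n), P.coeff S * ∏ j ∈ S, (((ξ j : ℤˣ) : ℤ) : ℝ)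

/-- `P` is of the form `∑_{|S| ≤ d} a_S ∏_{j ∈ S} x_j`. -/
def HasDegree (P : MultilinearPoly n) (d : ℕ) : Prop :=
  ∀ S : Finset (Fin n), d < S.card → P.coeff S = 0

/-- The influence `Inf_i(P) = ∑_{S ∋ i} a_S²` of the `i`-th variable. -/
def influence (P : MultilinearPoly n) (i : Fin n) : ℝ :=
  ∑ S : Finset (Fin n) with i ∈ S, P.coeff S ^ 2

/-- `P` is `τ`-regular: its `τ`-critical index is `0`, that is, the largest influence is at most
`τ` times the sum of all influences. -/
def IsRegular (P : MultilinearPoly n) (τ : ℝ) : Prop :=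
  ∀ i : Fin n, P.influence i ≤ τ * ∑ j : Fin n, P.influence j

/-- The polynomial `P_ρ` obtained from `P` by giving each variable `x_i`, `i ∈ S`, the value `ρ i`
(the values of `ρ` outside `S` are not used). It is a polynomial in the variables outside `S`: the
monomials meeting `S` get coefficient `0`, so the variables in `S` have influence `0`, and its
distribution under a uniform point of `{±1}^n` is the one under uniform `(x_i)_{i ∉ S}`. -/
def restrict (P : MultilinearPoly n) (S : Finset (Fin n)) (ρ : Cube n) : MultilinearPoly n where
  coeff T :=
    if Disjoint T S then
      ∑ U ∈ S.powerset, P.coeff (T ∪ U) * ∏ j ∈ U, (((ρ j : ℤˣ) : ℤ) : ℝ)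
    else 0

/-- The constant term; for `P.restrict S ρ` this is `P^*(ρ)`, the sum of the monomials of `P` in
the variables of `S` only, evaluated at `ρ`. -/
def constTerm (P : MultilinearPoly n) : ℝ := P.coeff ∅

/-- The non-constant part `q = P - P^*`, as a function on the cube. -/
def nonconst (P : MultilinearPoly n) (ξ : Cube n) : ℝ := P.eval ξ - P.constTerm

/-- `(C, β)`-tightness (of a polynomial of degree at most `d`). -/
def IsTight (P : MultilinearPoly n) (d : ℕ) (C β : ℝ) : Prop :=
  √(cubeVar P.nonconst) ≤ |P.constTerm| * (C * Real.log (1 / β)) ^ (-((d : ℝ) / 2)) ∧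
    1 - β ≤ cubeProb (fun ξ : Cube n => |P.nonconst ξ| ≤ 1 / 2 * |P.constTerm|)

end MultilinearPoly

/-- A binary decision tree whose internal nodes are labelled by variables `x_i`; the two subtrees
are those for `x_i = -1` and `x_i = 1`. -/
inductive DecisionTree (n : ℕ) : Type where
  | leaf : DecisionTree n
  | node (i : Fin n) (neg pos : DecisionTree n) : DecisionTree n

namespace DecisionTree

variable {n : ℕ}

/-- The length of a longest path from the root to a leaf. -/
def depth : DecisionTree n → ℕ
  | leaf => 0
  | node _ neg pos => max neg.depth pos.depth + 1

/-- The set of all variables that label a node of the tree. -/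
def vars : DecisionTree n → Finset (Fin n)
  | leaf => ∅
  | node i neg pos => insert i (neg.vars ∪ pos.vars)

/-- No variable is queried twice on a path from the root to a leaf. -/
def NoRepeat : DecisionTree n → Prop
  | leaf => True
  | node i neg pos => i ∉ neg.vars ∧ i ∉ pos.vars ∧ neg.NoRepeat ∧ pos.NoRepeat

/-- The set of variables queried on the path that the input `ξ` follows. -/
def queried : DecisionTree n → Cube n → Finset (Fin n)
  | leaf, _ => ∅
  | node i neg pos, ξ => insert i (if ξ i = 1 then pos.queried ξ else neg.queried ξ)

/-- The polynomial `P_ρ` at the leaf `ρ` that the input `ξ` reaches, when `P` is at the root: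
`ρ` fixes the variables queried on the way to the values that they have in `ξ`. -/
def leafPoly (T : DecisionTree n) (P : MultilinearPoly n) (ξ : Cube n) : MultilinearPoly n :=
  P.restrict (T.queried ξ) ξ

end DecisionTree

/-- `α = C (d log log (1/β) + d log d)`. -/
noncomputable def treeAlpha (C : ℝ) (d : ℕ) (β : ℝ) : ℝ :=
  C * ((d : ℝ) * Real.log (Real.log (1 / β)) + (d : ℝ) * Real.log d)

/-- `τ' = (C' d log d log (1/τ))^d τ`, where for `d = 1` the factor `log d` (which would make `τ'`
vanish) is read as `log 2`. -/
noncomputable def tauPrime (C' : ℝ) (d : ℕ) (τ : ℝ) : ℝ :=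
  (C' * (d : ℝ) * Real.log (max (d : ℝ) 2) * Real.log (1 / τ)) ^ d * τ

/-! ### Expectation and probability on the cube -/

section CubeExp

variable {n : ℕ}

/-! The tree is built in rounds, each succeeding with conditional probability at least `1/(8·9^d)`.
One round (`exists_restriction_set`) greedily collects into `S` variables whose influence exceeds
`τ` times the total influence still outside `S`, for at most `⌊α/τ⌋` steps, and queries all of `S`.
Each coefficient of `P_ρ` is itself a polynomial of degree at most `d` in `ρ`, so Bonami's
inequality (`cubeExp_walshSum_pow_le`) controls its moments. With Paley–Zygmund and Markov this
settles two cases.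

If the greedy choice halts, the influences outside `S` are balanced (`le_cubeProb_isRegular`).
Restriction preserves their means, so their sum exceeds half its mean `m` with probability at least
`1/(4·9^d)`. Moments of order about `log(1/τ)` and a union bound exclude a large single influence;
balance gives `∑ Inf_i^p ≤ (τm)^(p-1) m`, so the number of variables does not enter.

Otherwise the influence left outside `S` is at most `2e^{-α}` of the total (`le_cubeProb_isTight`).
By Parseval at least half of the variance passes into the mean of `P*(ρ)²`, so with probability
bounded below `P*(ρ)²` is large while `Var(q_ρ)` is tiny; a moment bound for `q_ρ` then gives
tightness.

Failing leaves start a fresh round on `P_ρ`, so failure probabilities multiply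
(`exists_tree_of_rounds`). A round queries only variables of positive influence in its starting
polynomial, and fixed variables have influence zero, so no variable repeats. -/

lemma cubeExp_add (f g : Cube n → ℝ) :
    cubeExp (fun ξ => f ξ + g ξ) = cubeExp f + cubeExp g := by
  simp only [cubeExp, Finset.sum_add_distrib, add_div]

lemma cubeExp_const_mul (c : ℝ) (f : Cube n → ℝ) :
    cubeExp (fun ξ => c * f ξ) = c * cubeExp f := by
  simp only [cubeExp, ← Finset.mul_sum, mul_div_assoc]

lemma cubeExp_sum {ι : Type*} (s : Finset ι) (f : ι → Cube n → ℝ) :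
    cubeExp (fun ξ => ∑ t ∈ s, f t ξ) = ∑ t ∈ s, cubeExp (f t) := by
  simp only [cubeExp, ← Finset.sum_div]
  rw [Finset.sum_comm]

lemma cubeExp_mono {f g : Cube n → ℝ} (h : ∀ ξ, f ξ ≤ g ξ) : cubeExp f ≤ cubeExp g := by
  unfold cubeExp
  gcongr
  exact h _

lemma cubeExp_const (c : ℝ) : cubeExp (fun _ : Cube n => c) = c := by
  simp [cubeExp, Fintype.card_pi]

lemma eq_zero_of_cubeExp_nonpos {f : Cube n → ℝ} (h : ∀ ξ, 0 ≤ f ξ) (h0 : cubeExp f ≤ 0)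
    (ξ : Cube n) : f ξ = 0 := by
  have h1 : ∑ ξ, f ξ ≤ 0 := by
    by_contra! hc
    exact absurd h0 (not_le.2 (div_pos hc (by positivity)))
  have h2 := (Finset.sum_eq_zero_iff_of_nonneg (fun ξ _ => h ξ)).1
    (le_antisymm h1 (Finset.sum_nonneg fun ξ _ => h ξ))
  exact h2 ξ (Finset.mem_univ _)

open Classical in
lemma cubeProb_eq_cubeExp (A : Cube n → Prop) :
    cubeProb A = cubeExp (fun ξ => if A ξ then 1 else 0) := by
  simp [cubeProb, cubeExp, Fintype.card_subtype]

lemma cubeProb_mono {A B : Cube n → Prop} (h : ∀ ξ, A ξ → B ξ) : cubeProb A ≤ cubeProb B := by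
  classical
  simp only [cubeProb_eq_cubeExp]
  refine cubeExp_mono fun ξ => ?_
  by_cases hA : A ξ
  · simp [hA, h ξ hA]
  · simp only [hA, if_false]
    split_ifs <;> norm_num

lemma cubeProb_not (A : Cube n → Prop) : cubeProb (fun ξ => ¬ A ξ) = 1 - cubeProb A := by
  classical
  have h : cubeProb A + cubeProb (fun ξ => ¬ A ξ) = 1 := by
    simp only [cubeProb_eq_cubeExp, ← cubeExp_add]
    refine (congrArg cubeExp (funext fun ξ => ?_)).trans (cubeExp_const 1)
    by_cases hA : A ξ <;> simp [hA]
  linarith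

/-- Markov's inequality. -/
lemma cubeProb_le_of_cubeExp_le {A : Cube n → Prop} {f : Cube n → ℝ} {m l : ℝ}
    (hf : ∀ ξ, 0 ≤ f ξ) (hA : ∀ ξ, A ξ → l ≤ f ξ) (hl : 0 < l) (hm : cubeExp f ≤ m) :
    cubeProb A ≤ m / l := by
  classical
  rw [le_div_iff₀ hl, mul_comm, cubeProb_eq_cubeExp, ← cubeExp_const_mul]
  refine (cubeExp_mono fun ξ => ?_).trans hm
  by_cases h : A ξ
  · simpa [h] using hA ξ h
  · simpa [h] using hf ξ

/-- The union bound. -/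
lemma cubeProb_exists_le {ι : Type*} (s : Finset ι) (A : ι → Cube n → Prop) :
    cubeProb (fun ξ => ∃ i ∈ s, A i ξ) ≤ ∑ i ∈ s, cubeProb (A i) := by
  classical
  simp only [cubeProb_eq_cubeExp, ← cubeExp_sum]
  refine cubeExp_mono fun ξ => ?_
  split_ifs with h
  · obtain ⟨i, hi, hA⟩ := h
    calc (1 : ℝ) = if A i ξ then 1 else 0 := by simp [hA]
      _ ≤ _ := Finset.single_le_sum (f := fun i => if A i ξ then (1 : ℝ) else 0)
        (fun j _ => by split_ifs <;> norm_num) hi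
  · exact Finset.sum_nonneg fun j _ => by split_ifs <;> norm_num

lemma cubeProb_le_one (A : Cube n → Prop) : cubeProb A ≤ 1 := by
  classical
  rw [cubeProb_eq_cubeExp]
  refine (cubeExp_mono (g := fun _ => 1) fun ξ => ?_).trans_eq (cubeExp_const 1)
  split_ifs <;> norm_num

lemma sub_le_cubeProb {A B D : Cube n → Prop} {a b : ℝ} (hA : a ≤ cubeProb A)
    (hB : cubeProb B ≤ b) (h : ∀ ξ, A ξ → ¬ B ξ → D ξ) : a - b ≤ cubeProb D := by
  classical
  have : cubeProb A ≤ cubeProb D + cubeProb B := by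
    simp only [cubeProb_eq_cubeExp, ← cubeExp_add]
    refine cubeExp_mono fun ξ => ?_
    by_cases hA : A ξ <;> by_cases hB : B ξ <;> by_cases hD : D ξ <;> simp [hA, hB, hD]
    exact absurd (h ξ hA hB) hD
  linarith

/-- A Paley–Zygmund inequality. -/
lemma le_cubeProb_of_cubeExp_sq_le {f : Cube n → ℝ} {B m : ℝ} (hm : 0 < m) (hB : 0 < B)
    (h1 : m ≤ cubeExp f) (h2 : cubeExp (fun ξ => f ξ ^ 2) ≤ B * m ^ 2) :
    1 / (4 * B) ≤ cubeProb (fun ξ => m / 2 ≤ f ξ) := by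
  classical
  -- Completing the square, `f ≤ f²/(4Bm) + Bm`, stands in for Cauchy–Schwarz on the event. Taking
  -- means leaves `m ≤ m/2 + m/4 + Bm·ℙ`.
  have key : cubeExp f ≤ cubeExp (fun ξ => (m / 2 + 1 / (4 * B * m) * f ξ ^ 2) +
      B * m * (if m / 2 ≤ f ξ then 1 else 0)) := by
    refine cubeExp_mono fun ξ => ?_
    have hsq : 0 ≤ 1 / (4 * B * m) * f ξ ^ 2 := by positivity
    split_ifs with h
    · have : 0 ≤ 1 / (4 * B * m) * (f ξ - 2 * B * m) ^ 2 := by positivity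
      have e : 1 / (4 * B * m) * (f ξ - 2 * B * m) ^ 2
          = 1 / (4 * B * m) * f ξ ^ 2 + B * m - f ξ := by
        field_simp
        ring
      linarith
    · linarith
  rw [cubeExp_add, cubeExp_add, cubeExp_const, cubeExp_const_mul, cubeExp_const_mul,
    ← cubeProb_eq_cubeExp] at key
  have h3 : 1 / (4 * B * m) * cubeExp (fun ξ => f ξ ^ 2) ≤ m / 4 := by
    calc _ ≤ 1 / (4 * B * m) * (B * m ^ 2) := by gcongr
      _ = m / 4 := by field_simp
  have h4 : m / 4 ≤ B * m * cubeProb (fun ξ => m / 2 ≤ f ξ) := by linarith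
  rw [div_le_iff₀ (by positivity)]
  have h5 : m * 1 ≤ m * (cubeProb (fun ξ => m / 2 ≤ f ξ) * (4 * B)) := by linarith
  exact le_of_mul_le_mul_left h5 hm

/-- Minkowski's inequality for `p`-th moments. -/
lemma cubeExp_sum_pow_le {ι : Type*} (s : Finset ι) (f : ι → Cube n → ℝ) (w : ι → ℝ) {p : ℕ}
    (hp : p ≠ 0) (hf : ∀ t ∈ s, ∀ ξ, 0 ≤ f t ξ) (hw : ∀ t ∈ s, 0 ≤ w t)
    (h : ∀ t ∈ s, cubeExp (fun ξ => f t ξ ^ p) ≤ w t ^ p) :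
    cubeExp (fun ξ => (∑ t ∈ s, f t ξ) ^ p) ≤ (∑ t ∈ s, w t) ^ p := by
  -- Every point has positive mass, so a zero moment kills `f t` everywhere and dividing by `w t`
  -- below is harmless.
  have hz : ∀ t ∈ s, w t = 0 → ∀ ξ, f t ξ = 0 := fun t ht h0 ξ => by
    have := eq_zero_of_cubeExp_nonpos (f := fun ξ => f t ξ ^ p)
      (fun ξ => pow_nonneg (hf t ht ξ) _) (by simpa [h0, hp] using h t ht) ξ
    exact pow_eq_zero_iff hp |>.1 this
  rcases (Finset.sum_nonneg hw).eq_or_lt with hW | hW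
  · have h0 := (Finset.sum_eq_zero_iff_of_nonneg hw).1 hW.symm
    have : (fun ξ => (∑ t ∈ s, f t ξ) ^ p) = fun _ : Cube n => (0 : ℝ) := by
      ext ξ
      rw [Finset.sum_eq_zero fun t ht => hz t ht (h0 t ht) ξ, zero_pow hp]
    rw [this, cubeExp_const]
    exact pow_nonneg hW.le _
  set W := ∑ t ∈ s, w t with hWdef
  -- Convexity of `x ↦ x^p` with weights `w t / W`, applied to the normalized functions `f t / w t`.
  have hpt : ∀ ξ, (∑ t ∈ s, f t ξ) ^ p ≤
      W ^ p * ∑ t ∈ s, w t / W * (1 / w t ^ p * f t ξ ^ p) := fun ξ => by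
    have hsum : ∑ t ∈ s, f t ξ = W * ∑ t ∈ s, w t / W * (f t ξ / w t) := by
      rw [Finset.mul_sum]
      refine Finset.sum_congr rfl fun t ht => ?_
      by_cases h0 : w t = 0
      · simp [h0, hz t ht h0 ξ]
      · field_simp
    rw [hsum, mul_pow]
    refine mul_le_mul_of_nonneg_left ?_ (pow_nonneg hW.le _)
    refine (Real.pow_arith_mean_le_arith_mean_pow s (fun t => w t / W) (fun t => f t ξ / w t)
      (fun t ht => div_nonneg (hw t ht) hW.le) ?_
      (fun t ht => div_nonneg (hf t ht ξ) (hw t ht)) p).trans_eq ?_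
    · rw [← Finset.sum_div, ← hWdef, div_self hW.ne']
    · refine Finset.sum_congr rfl fun t _ => ?_
      rw [div_pow]
      ring
  refine (cubeExp_mono hpt).trans ?_
  rw [cubeExp_const_mul, cubeExp_sum]
  refine mul_le_of_le_one_right (pow_nonneg hW.le _) ?_
  calc _ ≤ ∑ t ∈ s, w t / W := by
        refine Finset.sum_le_sum fun t ht => ?_
        rw [cubeExp_const_mul, cubeExp_const_mul]
        refine mul_le_of_le_one_right (div_nonneg (hw t ht) hW.le) ?_
        rcases (hw t ht).eq_or_lt with h0 | h0
        · simp [← h0, hp]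
        · rw [one_div, inv_mul_le_iff₀ (by positivity), mul_one]
          exact h t ht
    _ = 1 := by rw [← Finset.sum_div, ← hWdef, div_self hW.ne']

/-- The point `ξ` with its `i`-th coordinate negated. -/
def flipAt (i : Fin n) (ξ : Cube n) : Cube n := Function.update ξ i (-ξ i)

lemma flipAt_same (i : Fin n) (ξ : Cube n) : flipAt i ξ i = -ξ i := by simp [flipAt]

lemma flipAt_of_ne {i j : Fin n} (h : j ≠ i) (ξ : Cube n) : flipAt i ξ j = ξ j := by
  simp [flipAt, h]

lemma flipAt_involutive (i : Fin n) : Function.Involutive (flipAt i : Cube n → Cube n) := by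
  intro ξ
  ext j
  by_cases h : j = i
  · subst h; simp [flipAt_same]
  · simp [flipAt_of_ne h]

lemma cubeExp_flipAt (i : Fin n) (f : Cube n → ℝ) :
    cubeExp (fun ξ => f (flipAt i ξ)) = cubeExp f := by
  unfold cubeExp
  congr 1
  exact Equiv.sum_comp (flipAt_involutive i).toPerm f

lemma cubeExp_eq_flipAt_average (i : Fin n) (f : Cube n → ℝ) :
    cubeExp f = cubeExp (fun ξ => (f ξ + f (flipAt i ξ)) / 2) := by
  have h : (fun ξ => (f ξ + f (flipAt i ξ)) / 2) =
      fun ξ => (1 / 2) * (f ξ + f (flipAt i ξ)) := by ext; ring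
  rw [h, cubeExp_const_mul, cubeExp_add, cubeExp_flipAt]
  ring

/-- The events ignore coordinate `i`, which is thus a fair coin independent of both: `ξ` and `flipAt
i ξ` take one branch each. -/
lemma cubeProb_ite (i : Fin n) {A B : Cube n → Prop} (hA : ∀ ξ, A (flipAt i ξ) ↔ A ξ)
    (hB : ∀ ξ, B (flipAt i ξ) ↔ B ξ) :
    cubeProb (fun ξ => if ξ i = 1 then A ξ else B ξ) = (cubeProb A + cubeProb B) / 2 := by
  classical
  have h : (cubeProb A + cubeProb B) / 2 = 1 / 2 * (cubeProb A + cubeProb B) := by ring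
  rw [h]
  simp only [cubeProb_eq_cubeExp]
  rw [← cubeExp_add, ← cubeExp_const_mul, cubeExp_eq_flipAt_average i]
  congr 1
  ext ξ
  rw [flipAt_same]
  rcases Int.units_eq_one_or (ξ i) with h | h
  · have : ¬ ((-1 : ℤˣ) = 1) := by decide
    simp only [h, this, hB, if_true, if_false]
    ring
  · have : ¬ ((-1 : ℤˣ) = 1) := by decide
    simp only [h, this, hA, neg_neg, if_true, if_false]
    ring

end CubeExp

/-! ### Hypercontractivity of Walsh polynomials -/

section Walsh

variable {n : ℕ}

/-- The polynomial `∑_{U ⊆ V} b_U ∏_{j ∈ U} x_j` in the variables of `V`. -/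
def walshSum (V : Finset (Fin n)) (b : Finset (Fin n) → ℝ) (ξ : Cube n) : ℝ :=
  ∑ U ∈ V.powerset, b U * ∏ j ∈ U, (((ξ j : ℤˣ) : ℤ) : ℝ)

lemma walshSum_congr {V : Finset (Fin n)} (b : Finset (Fin n) → ℝ) {ξ ξ' : Cube n}
    (h : ∀ j ∈ V, ξ j = ξ' j) : walshSum V b ξ = walshSum V b ξ' := by
  refine Finset.sum_congr rfl fun U hU => ?_
  congr 1
  refine Finset.prod_congr rfl fun j hj => ?_
  rw [h j (Finset.mem_powerset.1 hU hj)]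

lemma walshSum_flipAt {V : Finset (Fin n)} (b : Finset (Fin n) → ℝ) {i : Fin n} (hi : i ∉ V)
    (ξ : Cube n) : walshSum V b (flipAt i ξ) = walshSum V b ξ :=
  walshSum_congr b fun _ hj => flipAt_of_ne (ne_of_mem_of_not_mem hj hi) ξ

lemma walshSum_insert {V : Finset (Fin n)} (b : Finset (Fin n) → ℝ) {i : Fin n} (hi : i ∉ V)
    (ξ : Cube n) : walshSum (insert i V) b ξ =
      walshSum V b ξ + (((ξ i : ℤˣ) : ℤ) : ℝ) * walshSum V (fun U => b (insert i U)) ξ := by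
  unfold walshSum
  rw [Finset.sum_powerset_insert hi, Finset.mul_sum]
  congr 1
  refine Finset.sum_congr rfl fun U hU => ?_
  rw [Finset.prod_insert fun h => hi (Finset.mem_powerset.1 hU h)]
  ring

lemma sign_sq (u : ℤˣ) : ((u : ℤ) : ℝ) ^ 2 = 1 := by
  rcases Int.units_eq_one_or u with h | h <;> simp [h]

/-- Parseval's identity. -/
lemma cubeExp_walshSum_sq (V : Finset (Fin n)) (b : Finset (Fin n) → ℝ) :
    cubeExp (fun ξ => walshSum V b ξ ^ 2) = ∑ U ∈ V.powerset, b U ^ 2 := by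
  induction V using Finset.induction_on generalizing b with
  | empty => simp [walshSum, cubeExp_const]
  | insert i V hi ih =>
    rw [Finset.sum_powerset_insert hi, ← ih b, ← ih fun U => b (insert i U), ← cubeExp_add,
      cubeExp_eq_flipAt_average i]
    congr 1
    ext ξ
    rw [walshSum_insert b hi, walshSum_insert b hi, walshSum_flipAt _ hi, walshSum_flipAt _ hi,
      flipAt_same]
    have := sign_sq (ξ i)
    push_cast
    linear_combination (walshSum V (fun U => b (insert i U)) ξ) ^ 2 * this

lemma sum_range_two_mul_add_one (g : ℕ → ℝ) (k : ℕ) :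
    ∑ m ∈ Finset.range (2 * k + 1), g m =
      ∑ j ∈ Finset.range (k + 1), g (2 * j) + ∑ j ∈ Finset.range k, g (2 * j + 1) := by
  induction k with
  | zero => simp
  | succ k ih =>
    rw [show 2 * (k + 1) + 1 = (2 * k + 1) + 1 + 1 by ring, Finset.sum_range_succ,
      Finset.sum_range_succ, ih, Finset.sum_range_succ _ (k + 1), Finset.sum_range_succ (fun j => g (2 * j + 1)) k,
      show 2 * (k + 1) = 2 * k + 1 + 1 by ring]
    ring

/-- Passing from `j` to `j + 1` multiplies the left side by `(k-j)/(j+1) · (2k-2j-1)/(2j+1)` and the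
right side by `(k-j)/(j+1) · (2k-1)`. -/
lemma choose_two_mul_le (k j : ℕ) :
    (2 * k).choose (2 * j) ≤ (2 * k - 1) ^ j * k.choose j := by
  induction j with
  | zero => simp
  | succ j ih =>
    rcases Nat.lt_or_ge j k with hjk | hjk
    swap
    · rw [Nat.choose_eq_zero_of_lt (by omega)]
      exact Nat.zero_le _
    have h1 := Nat.choose_succ_right_eq (2 * k) (2 * j)
    have h2 := Nat.choose_succ_right_eq (2 * k) (2 * j + 1)
    have h3 := Nat.choose_succ_right_eq k j
    obtain ⟨m, rfl⟩ := Nat.exists_eq_add_of_lt hjk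
    rw [show 2 * (j + m + 1) - 2 * j = 2 * (m + 1) by omega] at h1
    rw [show 2 * (j + m + 1) - (2 * j + 1) = 2 * m + 1 by omega] at h2
    rw [show j + m + 1 - j = m + 1 by omega] at h3
    rw [show 2 * (j + 1) = 2 * j + 1 + 1 by ring]
    set c := 2 * (j + m + 1) - 1 with hc
    set X := (2 * (j + m + 1)).choose (2 * j)
    set Y := (2 * (j + m + 1)).choose (2 * j + 1)
    set Z := (2 * (j + m + 1)).choose (2 * j + 1 + 1)
    set A := (j + m + 1).choose j
    set B := (j + m + 1).choose (j + 1)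
    have h4 : Z * (2 * (j + 1)) * (2 * j + 1) = X * (2 * (m + 1)) * (2 * m + 1) := by
      rw [← h1, show 2 * (j + 1) = 2 * j + 1 + 1 by ring, h2]
      ring
    have h5 : (2 * (j + 1)) * Z ≤ (2 * (j + 1)) * (c ^ (j + 1) * B) := by
      calc (2 * (j + 1)) * Z ≤ Z * (2 * (j + 1)) * (2 * j + 1) := by
            rw [mul_comm (2 * (j + 1))]
            exact Nat.le_mul_of_pos_right _ (by omega)
        _ = X * (2 * (m + 1)) * (2 * m + 1) := h4
        _ ≤ (c ^ j * A) * (2 * (m + 1)) * c := by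
          gcongr
          omega
        _ = 2 * c ^ (j + 1) * (A * (m + 1)) := by ring
        _ = _ := by rw [← h3]; ring
    exact Nat.le_of_mul_le_mul_left h5 (by positivity)

/-- Odd powers of `b` cancel in the average, and the even ones are compared term by term with the
binomial expansion on the right. This is hypercontractivity for a single sign. -/
lemma two_point_inequality (a b : ℝ) {k : ℕ} (hk : k ≠ 0) :
    ((a + b) ^ (2 * k) + (a - b) ^ (2 * k)) / 2 ≤ (a ^ 2 + (2 * k - 1) * b ^ 2) ^ k := by
  have hexp : ((a + b) ^ (2 * k) + (a - b) ^ (2 * k)) / 2 =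
      ∑ j ∈ Finset.range (k + 1), (b ^ 2) ^ j * (a ^ 2) ^ (k - j) * ((2 * k).choose (2 * j)) := by
    rw [sub_eq_add_neg, add_comm a b, add_comm a (-b), add_pow, add_pow, ← Finset.sum_add_distrib,
      sum_range_two_mul_add_one, Finset.sum_eq_zero (s := Finset.range k), add_zero,
      Finset.sum_div]
    · refine Finset.sum_congr rfl fun j hj => ?_
      rw [Even.neg_pow (even_two_mul j), pow_mul, ← Nat.mul_sub, pow_mul]
      ring
    · intro j _
      rw [Odd.neg_pow (odd_two_mul_add_one j)]
      ring
  rw [hexp, add_comm (a ^ 2), add_pow]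
  refine Finset.sum_le_sum fun j _ => ?_
  have h := choose_two_mul_le k j
  have h' : ((2 * k).choose (2 * j) : ℝ) ≤ (2 * k - 1) ^ j * k.choose j := by
    have hc : ((2 * k - 1 : ℕ) : ℝ) = 2 * k - 1 := by
      rw [Nat.cast_sub (by omega)]
      push_cast
      ring
    rw [← hc]
    exact_mod_cast h
  calc _ ≤ (b ^ 2) ^ j * (a ^ 2) ^ (k - j) * ((2 * k - 1) ^ j * k.choose j) := by gcongr
    _ = _ := by rw [mul_pow]; ring

/-- Bonami's hypercontractive inequality for even moments. -/
theorem cubeExp_walshSum_pow_le {k : ℕ} (hk : k ≠ 0) (V : Finset (Fin n)) (d : ℕ)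
    (b : Finset (Fin n) → ℝ) (hb : ∀ U ⊆ V, d < U.card → b U = 0) :
    cubeExp (fun ξ => (walshSum V b ξ ^ 2) ^ k) ≤
      ((2 * k - 1) ^ d * ∑ U ∈ V.powerset, b U ^ 2) ^ k := by
  have hc : (1 : ℝ) ≤ 2 * k - 1 := by
    have : (1 : ℝ) ≤ k := by exact_mod_cast Nat.one_le_iff_ne_zero.2 hk
    linarith
  induction V using Finset.induction_on generalizing b d with
  | empty =>
    simp only [walshSum, Finset.powerset_empty, Finset.sum_singleton, Finset.prod_empty, mul_one,
      cubeExp_const]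
    gcongr
    exact le_mul_of_one_le_left (sq_nonneg _) (one_le_pow₀ hc)
  | insert i V hi ih =>
    set A := walshSum V (fun U => b (insert i U)) with hA
    set B := walshSum V b with hB
    have hBm := ih d b fun U hU => hb U (hU.trans (Finset.subset_insert _ _))
    -- `A` has degree one less than the whole, which pays for the extra factor `2k - 1`; for `d = 0`
    -- it vanishes.
    have hAm : cubeExp (fun ξ => ((2 * k - 1) * A ξ ^ 2) ^ k) ≤
        ((2 * k - 1) ^ d * ∑ U ∈ V.powerset, b (insert i U) ^ 2) ^ k := by
      simp only [mul_pow _ _ k]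
      rw [cubeExp_const_mul]
      cases d with
      | zero =>
        have h0 : ∀ U ∈ V.powerset, b (insert i U) = 0 := fun U hU =>
          hb _ (Finset.insert_subset_insert _ (Finset.mem_powerset.1 hU))
            (Finset.card_pos.2 (Finset.insert_nonempty _ _))
        have hA0 : ∀ ξ, A ξ = 0 := fun ξ =>
          Finset.sum_eq_zero fun U hU => by simp only [h0 U hU, zero_mul]
        simp only [hA0]
        simp only [ne_eq, OfNat.ofNat_ne_zero, not_false_eq_true, zero_pow, hk, cubeExp_const,
          mul_zero]
        positivity
      | succ d =>
        have := ih d (fun U => b (insert i U)) fun U hU hd =>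
          hb _ (Finset.insert_subset_insert _ hU) (by
            rw [Finset.card_insert_of_notMem fun h => hi (hU h)]
            omega)
        calc _ ≤ (2 * k - 1) ^ k *
              ((2 * k - 1) ^ d * ∑ U ∈ V.powerset, b (insert i U) ^ 2 : ℝ) ^ k := by gcongr
          _ = _ := by rw [pow_succ (2 * (k : ℝ) - 1) d]; simp only [mul_pow]; ring
    rw [cubeExp_eq_flipAt_average i, Finset.sum_powerset_insert hi, mul_add]
    have hpt : ∀ ξ, ((walshSum (insert i V) b ξ ^ 2) ^ k +
        (walshSum (insert i V) b (flipAt i ξ) ^ 2) ^ k) / 2 ≤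
        (B ξ ^ 2 + (2 * k - 1) * A ξ ^ 2) ^ k := fun ξ => by
      have h := two_point_inequality (B ξ) ((((ξ i : ℤˣ) : ℤ) : ℝ) * A ξ) hk
      rw [mul_pow _ (A ξ), sign_sq, one_mul] at h
      rw [walshSum_insert b hi, walshSum_insert b hi, walshSum_flipAt _ hi, walshSum_flipAt _ hi,
        flipAt_same, ← pow_mul, ← pow_mul]
      refine le_of_eq_of_le ?_ h
      push_cast
      ring
    refine (cubeExp_mono hpt).trans ?_
    -- Minkowski for the two nonnegative functions `B²` and `(2k-1)A²`.
    have := cubeExp_sum_pow_le (n := n) (Finset.univ : Finset Bool)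
      (fun t ξ => if t then B ξ ^ 2 else (2 * k - 1) * A ξ ^ 2)
      (fun t => if t then (2 * k - 1) ^ d * ∑ U ∈ V.powerset, b U ^ 2
        else (2 * k - 1) ^ d * ∑ U ∈ V.powerset, b (insert i U) ^ 2) hk ?_ ?_ ?_
    · simpa using this
    · rintro (_ | _) _ ξ
      · simp only [Bool.false_eq_true, if_false]; positivity
      · simp only [if_true]; positivity
    · rintro (_ | _) _
      · simp only [Bool.false_eq_true, if_false]; positivity
      · simp only [if_true]; positivity
    · rintro (_ | _) _
      · simpa using hAm
      · simpa using hBm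

end Walsh

/-! ### Random restrictions -/

namespace MultilinearPoly

variable {n : ℕ}

lemma influence_nonneg (P : MultilinearPoly n) (i : Fin n) : 0 ≤ P.influence i :=
  Finset.sum_nonneg fun _ _ => sq_nonneg _

lemma eval_eq_walshSum (P : MultilinearPoly n) : P.eval = walshSum Finset.univ P.coeff := by
  ext ξ
  simp [eval, walshSum]

lemma restrict_coeff (P : MultilinearPoly n) (S : Finset (Fin n)) (ξ : Cube n)
    (T : Finset (Fin n)) : (P.restrict S ξ).coeff T =
      if Disjoint T S then walshSum S (fun U => P.coeff (T ∪ U)) ξ else 0 := rfl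

lemma restrict_congr (P : MultilinearPoly n) {S : Finset (Fin n)} {ξ ξ' : Cube n}
    (h : ∀ j ∈ S, ξ j = ξ' j) : P.restrict S ξ = P.restrict S ξ' := by
  unfold restrict
  congr 1
  ext T
  split_ifs
  · exact walshSum_congr _ h
  · rfl

lemma restrict_empty (P : MultilinearPoly n) (ξ : Cube n) : P.restrict ∅ ξ = P := by
  cases P
  simp [restrict]

lemma HasDegree.restrict {P : MultilinearPoly n} {d : ℕ} (h : P.HasDegree d)
    (S : Finset (Fin n)) (ξ : Cube n) : (P.restrict S ξ).HasDegree d := by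
  intro T hT
  rw [restrict_coeff]
  split_ifs
  · refine Finset.sum_eq_zero fun U _ => ?_
    simp only [h _ (hT.trans_le (Finset.card_le_card Finset.subset_union_left)), zero_mul]
  · rfl

lemma restrict_influence_of_mem (P : MultilinearPoly n) {S : Finset (Fin n)} (ξ : Cube n)
    {i : Fin n} (hi : i ∈ S) : (P.restrict S ξ).influence i = 0 := by
  refine Finset.sum_eq_zero fun T hT => ?_
  rw [restrict_coeff, if_neg, zero_pow two_ne_zero]
  exact Finset.not_disjoint_iff.2 ⟨i, (Finset.mem_filter.1 hT).2, hi⟩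

/-- Coefficients of the restriction at sets containing `i` combine coefficients of `P` at sets
containing `i`. This carries the positivity that prevents repeated queries back to the root. -/
lemma influence_pos_of_restrict {P : MultilinearPoly n} {S : Finset (Fin n)} {ξ : Cube n}
    {i : Fin n} (h : 0 < (P.restrict S ξ).influence i) : 0 < P.influence i := by
  refine (P.influence_nonneg i).lt_of_ne fun h0 => h.ne' ?_
  have hc := (Finset.sum_eq_zero_iff_of_nonneg fun T _ => sq_nonneg (P.coeff T)).1 h0.symm
  refine Finset.sum_eq_zero fun T hT => ?_
  rw [restrict_coeff]
  split_ifs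
  · rw [walshSum, Finset.sum_eq_zero, zero_pow two_ne_zero]
    intro U _
    have : P.coeff (T ∪ U) ^ 2 = 0 := hc _ (by
      simp only [Finset.mem_filter, Finset.mem_univ, true_and, Finset.mem_union] at hT ⊢
      exact Or.inl hT)
    rw [pow_eq_zero_iff two_ne_zero |>.1 this, zero_mul]
  · exact zero_pow two_ne_zero

/-- Restrictions compose. -/
lemma restrict_insert (P : MultilinearPoly n) {i : Fin n} {S : Finset (Fin n)} (hi : i ∉ S)
    (ξ : Cube n) : P.restrict (insert i S) ξ = (P.restrict {i} ξ).restrict S ξ := by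
  have key : ∀ T, (P.restrict (insert i S) ξ).coeff T =
      ((P.restrict {i} ξ).restrict S ξ).coeff T := fun T => by
    rw [restrict_coeff, restrict_coeff]
    by_cases hT : i ∈ T
    · rw [if_neg (Finset.not_disjoint_iff.2 ⟨i, hT, Finset.mem_insert_self _ _⟩)]
      split_ifs
      · refine (Finset.sum_eq_zero fun U _ => ?_).symm
        have : ¬ Disjoint (T ∪ U) {i} := by simp [hT]
        simp only [restrict_coeff, if_neg this, zero_mul]
      · rfl
    · have hd : Disjoint T (insert i S) ↔ Disjoint T S := by
        rw [Finset.disjoint_insert_right]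
        simp [hT]
      simp only [hd]
      split_ifs
      · rw [walshSum_insert _ hi]
        unfold walshSum
        rw [Finset.mul_sum, ← Finset.sum_add_distrib]
        refine Finset.sum_congr rfl fun U hU => ?_
        have hiU : i ∉ U := fun h => hi (Finset.mem_powerset.1 hU h)
        have hs : walshSum {i} (fun W => P.coeff (T ∪ U ∪ W)) ξ = _ :=
          walshSum_insert _ (Finset.notMem_empty i) ξ
        have hTU : Disjoint (T ∪ U) {i} := by simp [hT, hiU]
        simp only [restrict_coeff, if_pos hTU, hs]
        simp only [walshSum, Finset.powerset_empty, Finset.sum_singleton, Finset.union_empty,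
          Finset.prod_empty, mul_one, Finset.union_insert]
        ring
      · rfl
  have hext : ∀ Q R : MultilinearPoly n, (∀ T, Q.coeff T = R.coeff T) → Q = R := by
    rintro ⟨q⟩ ⟨r⟩ h
    congr
    exact funext h
  exact hext _ _ key

/-- Every `W` splits uniquely as `(W \ S) ∪ (W ∩ S)`. -/
lemma sum_disjoint_powerset (S : Finset (Fin n)) (h : Finset (Fin n) → ℝ) :
    ∑ T : Finset (Fin n) with Disjoint T S, ∑ U ∈ S.powerset, h (T ∪ U) = ∑ W, h W := by
  rw [← Finset.sum_product']
  refine Finset.sum_bij' (fun x _ => x.1 ∪ x.2) (fun W _ => (W \ S, W ∩ S)) ?_ ?_ ?_ ?_ ?_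
  · simp
  · intro W _
    simp only [Finset.mem_product, Finset.mem_filter, Finset.mem_univ, true_and,
      Finset.mem_powerset]
    exact ⟨Finset.sdiff_disjoint, Finset.inter_subset_right⟩
  · rintro ⟨T, U⟩ hx
    simp only [Finset.mem_product, Finset.mem_filter, Finset.mem_univ, true_and,
      Finset.mem_powerset] at hx
    obtain ⟨h1, h2⟩ := hx
    ext j
    · have : j ∈ T → j ∉ S := fun h => Finset.disjoint_left.1 h1 h
      have := @h2 j
      simp only [Finset.mem_sdiff, Finset.mem_union]
      tauto
    · have : j ∈ T → j ∉ S := fun h => Finset.disjoint_left.1 h1 h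
      have := @h2 j
      simp only [Finset.mem_inter, Finset.mem_union]
      tauto
  · intro W _
    exact Finset.sdiff_union_inter W S
  · simp

/-- The mean square of the `T`-th coefficient of a random restriction to the complement of `S`. -/
noncomputable def coeffWeight (P : MultilinearPoly n) (S T : Finset (Fin n)) : ℝ :=
  if Disjoint T S then ∑ U ∈ S.powerset, P.coeff (T ∪ U) ^ 2 else 0

lemma coeffWeight_nonneg (P : MultilinearPoly n) (S T : Finset (Fin n)) :
    0 ≤ P.coeffWeight S T := by
  unfold coeffWeight
  split_ifs
  · exact Finset.sum_nonneg fun _ _ => sq_nonneg _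
  · rfl

lemma cubeExp_restrict_coeff_sq (P : MultilinearPoly n) (S T : Finset (Fin n)) :
    cubeExp (fun ξ => (P.restrict S ξ).coeff T ^ 2) = P.coeffWeight S T := by
  simp only [restrict_coeff, coeffWeight]
  split_ifs
  · exact cubeExp_walshSum_sq _ _
  · simp [cubeExp_const]

lemma cubeExp_restrict_coeff_pow_le {P : MultilinearPoly n} {d : ℕ} (hP : P.HasDegree d)
    (S T : Finset (Fin n)) {k : ℕ} (hk : k ≠ 0) :
    cubeExp (fun ξ => ((P.restrict S ξ).coeff T ^ 2) ^ k) ≤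
      ((2 * k - 1) ^ d * P.coeffWeight S T) ^ k := by
  simp only [restrict_coeff, coeffWeight]
  split_ifs
  · refine cubeExp_walshSum_pow_le hk S d _ fun U _ hU => hP _ ?_
    exact hU.trans_le (Finset.card_le_card Finset.subset_union_right)
  · simp [hk, cubeExp_const]

lemma sum_coeffWeight (P : MultilinearPoly n) (S : Finset (Fin n)) :
    ∑ T, P.coeffWeight S T = ∑ W, P.coeff W ^ 2 := by
  rw [← sum_disjoint_powerset S fun W => P.coeff W ^ 2, Finset.sum_filter]
  rfl

lemma sum_coeffWeight_of_notMem (P : MultilinearPoly n) {S : Finset (Fin n)} {i : Fin n}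
    (hi : i ∉ S) : ∑ T : Finset (Fin n) with i ∈ T, P.coeffWeight S T = P.influence i := by
  rw [influence, Finset.sum_filter (fun T : Finset (Fin n) => i ∈ T) fun W => P.coeff W ^ 2,
    ← sum_disjoint_powerset S, Finset.sum_filter, Finset.sum_filter]
  refine Finset.sum_congr rfl fun T _ => ?_
  unfold coeffWeight
  split_ifs with h1 h2 h2
  · refine Finset.sum_congr rfl fun U _ => ?_
    rw [if_pos (Finset.mem_union_left _ h1)]
  · rfl
  · refine (Finset.sum_eq_zero fun U hU => ?_).symm
    rw [if_neg]
    simp only [Finset.mem_union, h1, false_or]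
    exact fun h => hi (Finset.mem_powerset.1 hU h)
  · rfl

lemma cubeExp_restrict_influence (P : MultilinearPoly n) {S : Finset (Fin n)} {i : Fin n}
    (hi : i ∉ S) : cubeExp (fun ξ => (P.restrict S ξ).influence i) = P.influence i := by
  simp only [influence]
  rw [cubeExp_sum]
  simp only [cubeExp_restrict_coeff_sq]
  exact sum_coeffWeight_of_notMem P hi

/-- An influence is a sum of squared coefficients; Minkowski lets Bonami act on each one without
loss in their number. -/
lemma cubeExp_restrict_influence_pow_le {P : MultilinearPoly n} {d : ℕ} (hP : P.HasDegree d)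
    {S : Finset (Fin n)} {i : Fin n} (hi : i ∉ S) {k : ℕ} (hk : k ≠ 0) :
    cubeExp (fun ξ => (P.restrict S ξ).influence i ^ k) ≤
      ((2 * k - 1) ^ d * P.influence i) ^ k := by
  have hc : (0 : ℝ) ≤ 2 * k - 1 := by
    have : (1 : ℝ) ≤ k := by exact_mod_cast Nat.one_le_iff_ne_zero.2 hk
    linarith
  rw [← sum_coeffWeight_of_notMem P hi, Finset.mul_sum]
  exact cubeExp_sum_pow_le _ _ _ hk (fun T _ ξ => sq_nonneg _)
    (fun T _ => mul_nonneg (pow_nonneg hc _) (P.coeffWeight_nonneg S T))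
    (fun T _ => cubeExp_restrict_coeff_pow_le hP S T hk)

lemma sum_restrict_influence (P : MultilinearPoly n) (S : Finset (Fin n)) (ξ : Cube n) :
    ∑ i, (P.restrict S ξ).influence i = ∑ i ∈ Sᶜ, (P.restrict S ξ).influence i := by
  refine (Finset.sum_subset (Finset.subset_univ _) fun i _ hi => ?_).symm
  exact restrict_influence_of_mem P ξ (by simpa using hi)

lemma cubeExp_sum_restrict_influence (P : MultilinearPoly n) (S : Finset (Fin n)) :
    cubeExp (fun ξ => ∑ i, (P.restrict S ξ).influence i) = ∑ i ∈ Sᶜ, P.influence i := by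
  simp only [sum_restrict_influence]
  rw [cubeExp_sum]
  exact Finset.sum_congr rfl fun i hi =>
    cubeExp_restrict_influence P (Finset.mem_compl.1 hi)

lemma cubeExp_sum_restrict_influence_sq_le {P : MultilinearPoly n} {d : ℕ} (hP : P.HasDegree d)
    (S : Finset (Fin n)) :
    cubeExp (fun ξ => (∑ i, (P.restrict S ξ).influence i) ^ 2) ≤
      9 ^ d * (∑ i ∈ Sᶜ, P.influence i) ^ 2 := by
  simp only [sum_restrict_influence]
  refine (cubeExp_sum_pow_le _ _ (fun i => 3 ^ d * P.influence i) two_ne_zero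
    (fun i _ ξ => influence_nonneg _ _) (fun i _ => mul_nonneg (by positivity)
      (influence_nonneg _ _)) fun i hi => ?_).trans_eq ?_
  · refine (cubeExp_restrict_influence_pow_le hP (Finset.mem_compl.1 hi) two_ne_zero).trans_eq ?_
    norm_num
  · rw [← Finset.mul_sum, mul_pow, ← pow_mul, mul_comm d, pow_mul]
    norm_num

/-! ### Total influence versus variance -/

lemma sum_influence (P : MultilinearPoly n) :
    ∑ i, P.influence i = ∑ T, (T.card : ℝ) * P.coeff T ^ 2 := by
  simp only [influence, Finset.sum_filter]
  rw [Finset.sum_comm]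
  refine Finset.sum_congr rfl fun T _ => ?_
  rw [← Finset.sum_filter]
  simp

/-- The variance `∑_{T ≠ ∅} a_T²` in terms of the coefficients. -/
noncomputable def coeffVar (P : MultilinearPoly n) : ℝ := ∑ T, if T = ∅ then 0 else P.coeff T ^ 2

lemma coeffVar_nonneg (P : MultilinearPoly n) : 0 ≤ P.coeffVar :=
  Finset.sum_nonneg fun T _ => by split_ifs <;> positivity

lemma constTerm_sq_add_coeffVar (P : MultilinearPoly n) :
    P.constTerm ^ 2 + P.coeffVar = ∑ T, P.coeff T ^ 2 := by
  unfold coeffVar constTerm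
  have : P.coeff ∅ ^ 2 = ∑ T : Finset (Fin n), if T = ∅ then P.coeff T ^ 2 else 0 := by simp
  rw [this, ← Finset.sum_add_distrib]
  refine Finset.sum_congr rfl fun T _ => ?_
  split_ifs <;> simp

lemma coeffVar_le_sum_influence (P : MultilinearPoly n) : P.coeffVar ≤ ∑ i, P.influence i := by
  rw [sum_influence]
  refine Finset.sum_le_sum fun T _ => ?_
  split_ifs with h
  · simp [h]
  · refine le_mul_of_one_le_left (sq_nonneg _) ?_
    exact_mod_cast Finset.card_pos.2 (Finset.nonempty_iff_ne_empty.2 h)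

lemma HasDegree.sum_influence_le {P : MultilinearPoly n} {d : ℕ} (hP : P.HasDegree d) :
    ∑ i, P.influence i ≤ d * P.coeffVar := by
  rw [sum_influence, coeffVar, Finset.mul_sum]
  refine Finset.sum_le_sum fun T _ => ?_
  split_ifs with h
  · simp [h]
  · rcases lt_or_ge d T.card with h1 | h1
    · simp [hP T h1]
    · gcongr

/-! ### Tightness -/

lemma nonconst_eq_walshSum (P : MultilinearPoly n) (ξ : Cube n) :
    P.nonconst ξ = walshSum Finset.univ (fun T => if T = ∅ then 0 else P.coeff T) ξ := by
  unfold nonconst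
  rw [eval_eq_walshSum, sub_eq_iff_eq_add, constTerm]
  have : P.coeff ∅ = ∑ T : Finset (Fin n), if T = ∅ then P.coeff ∅ else 0 := by simp
  rw [this]
  simp only [walshSum, Finset.powerset_univ]
  rw [← Finset.sum_add_distrib]
  refine Finset.sum_congr rfl fun T _ => ?_
  split_ifs with h
  · simp [h]
  · simp

lemma cubeExp_nonconst_sq (P : MultilinearPoly n) :
    cubeExp (fun ξ => P.nonconst ξ ^ 2) = P.coeffVar := by
  simp only [nonconst_eq_walshSum]
  rw [cubeExp_walshSum_sq, coeffVar, Finset.powerset_univ]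
  exact Finset.sum_congr rfl fun T _ => by split_ifs <;> simp

lemma HasDegree.cubeExp_nonconst_pow_le {P : MultilinearPoly n} {d : ℕ} (hP : P.HasDegree d)
    {k : ℕ} (hk : k ≠ 0) :
    cubeExp (fun ξ => (P.nonconst ξ ^ 2) ^ k) ≤ ((2 * k - 1) ^ d * P.coeffVar) ^ k := by
  simp only [nonconst_eq_walshSum]
  refine (cubeExp_walshSum_pow_le hk _ d _ fun T _ hT => ?_).trans_eq ?_
  · simp [hP T hT]
  · rw [coeffVar, Finset.powerset_univ]
    congr 2
    exact Finset.sum_congr rfl fun T _ => by split_ifs <;> simp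

lemma cubeVar_le (f : Cube n → ℝ) : cubeVar f ≤ cubeExp (fun ξ => f ξ ^ 2) := by
  unfold cubeVar
  have h : (fun ξ => (f ξ - cubeExp f) ^ 2) =
      fun ξ => (f ξ ^ 2 + (-2 * cubeExp f) * f ξ) + cubeExp f ^ 2 := by ext; ring
  rw [h, cubeExp_add, cubeExp_add, cubeExp_const, cubeExp_const_mul]
  nlinarith [sq_nonneg (cubeExp f)]

/-- The first half of tightness is the square root of `h`. The second is Markov for the moment of
order `2k`, `k = ⌈log(1/β)⌉`: the moment ratio is at most `(4/25)^k ≤ e^{-k} ≤ β`. -/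
lemma isTight_of_coeffVar_le {P : MultilinearPoly n} {d : ℕ} (hd : 1 ≤ d) (hP : P.HasDegree d)
    {C β : ℝ} (hC : 100 ≤ C) (hβ : 0 < β) (hβ1 : β < 1 / 3) (h0 : P.constTerm ≠ 0)
    (h : P.coeffVar * (C * Real.log (1 / β)) ^ d ≤ P.constTerm ^ 2) : P.IsTight d C β := by
  set l := Real.log (1 / β) with hl
  have hl1 : 1 < l := by
    rw [hl, Real.lt_log_iff_exp_lt (by positivity), lt_div_iff₀ hβ]
    have := Real.exp_one_lt_d9
    nlinarith
  have hCl : 0 < C * l := by positivity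
  have hX : P.coeffVar ≤ P.constTerm ^ 2 / (C * l) ^ d := by
    rwa [le_div_iff₀ (by positivity)]
  refine ⟨?_, ?_⟩
  · rw [Real.sqrt_le_left (by positivity)]
    refine (cubeVar_le _).trans ?_
    rw [cubeExp_nonconst_sq, mul_pow, sq_abs, ← hl,
      ← Real.rpow_natCast ((C * l) ^ (-((d : ℝ) / 2))) 2, ← Real.rpow_mul hCl.le]
    refine hX.trans_eq ?_
    rw [show -((d : ℝ) / 2) * ((2 : ℕ) : ℝ) = -(d : ℝ) by push_cast; ring, Real.rpow_neg hCl.le,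
      Real.rpow_natCast]
    rfl
  · have hc2 : 0 < P.constTerm ^ 2 := by positivity
    set k := ⌈l⌉₊ with hkdef
    have hk : k ≠ 0 := (Nat.ceil_pos.2 (by linarith)).ne'
    have hkl : l ≤ k := Nat.le_ceil _
    have hkl2 : (k : ℝ) ≤ 2 * l := by
      have := Nat.ceil_lt_add_one (show 0 ≤ l by linarith)
      linarith
    have hM := cubeProb_le_of_cubeExp_le
      (A := fun ξ => ¬ |P.nonconst ξ| ≤ 1 / 2 * |P.constTerm|)
      (f := fun ξ => (P.nonconst ξ ^ 2) ^ k) (l := (P.constTerm ^ 2 / 4) ^ k)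
      (fun ξ => by positivity) (fun ξ hξ => by
        gcongr
        rw [not_le] at hξ
        have := pow_lt_pow_left₀ hξ (by positivity) two_ne_zero
        rw [mul_pow, sq_abs, sq_abs] at this
        linarith) (by positivity) (hP.cubeExp_nonconst_pow_le hk)
    rw [cubeProb_not] at hM
    have hr : ((2 * k - 1) ^ d * P.coeffVar) ^ k / (P.constTerm ^ 2 / 4) ^ k ≤ β := by
      have h1k : (0 : ℝ) ≤ 2 * k - 1 := by linarith
      -- Since `2k - 1 ≤ 4l`, the ratio is at most `4(4/C)^d`, and `C ≥ 100`, `d ≥ 1` give `4/25`.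
      have hbase : (2 * k - 1) ^ d * P.coeffVar / (P.constTerm ^ 2 / 4) ≤ 4 / 25 := by
        calc _ ≤ (4 * l) ^ d * (P.constTerm ^ 2 / (C * l) ^ d) / (P.constTerm ^ 2 / 4) := by
              refine div_le_div_of_nonneg_right ?_ (by positivity)
              refine mul_le_mul (pow_le_pow_left₀ h1k (by linarith) _) hX P.coeffVar_nonneg ?_
              positivity
          _ = 4 * (4 / C) ^ d := by
              rw [mul_pow, mul_pow, div_pow]
              have : l ^ d ≠ 0 := by positivity
              field_simp
          _ ≤ 4 * (4 / 100) ^ d := by gcongr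
          _ ≤ 4 * (4 / 100) ^ 1 := by
              refine mul_le_mul_of_nonneg_left ?_ (by norm_num)
              exact pow_le_pow_of_le_one (by norm_num) (by norm_num) hd
          _ = _ := by norm_num
      rw [← div_pow]
      calc _ ≤ (4 / 25 : ℝ) ^ k := by
            refine pow_le_pow_left₀ ?_ hbase _
            exact div_nonneg (mul_nonneg (pow_nonneg h1k _) P.coeffVar_nonneg) (by positivity)
        _ ≤ Real.exp (-1) ^ k := by
            refine pow_le_pow_left₀ (by norm_num) ?_ _
            rw [Real.exp_neg, ← one_div, le_div_iff₀ (Real.exp_pos _)]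
            have := Real.exp_one_lt_d9
            linarith
        _ = Real.exp (-k) := by rw [← Real.exp_nat_mul]; ring_nf
        _ ≤ Real.exp (-l) := Real.exp_le_exp.2 (by linarith)
        _ = β := by rw [hl, ← Real.log_inv, Real.exp_log (by positivity)]; simp
    linarith [hM.trans hr]

end MultilinearPoly

/-! ### One round of restrictions -/

namespace MultilinearPoly

variable {n : ℕ}

/-- Greedy choice of influential variables: after `K` steps either the remaining influences are
balanced, or their sum has decreased by the factor `(1 - τ)^K`. -/
lemma exists_greedy_set (v : Fin n → ℝ) (hv : ∀ i, 0 ≤ v i) {τ : ℝ} (hτ : 0 < τ) (hτ1 : τ < 1)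
    (K : ℕ) : ∃ S : Finset (Fin n), S.card ≤ K ∧ (∀ i ∈ S, 0 < v i) ∧
      ((∀ i ∉ S, v i ≤ τ * ∑ j ∈ Sᶜ, v j) ∨ ∑ j ∈ Sᶜ, v j ≤ (1 - τ) ^ K * ∑ j, v j) := by
  induction K with
  | zero => exact ⟨∅, by simp, by simp, Or.inr (by simp)⟩
  | succ K ih =>
    obtain ⟨S, hc, hp, h⟩ := ih
    by_cases hS : ∀ i ∉ S, v i ≤ τ * ∑ j ∈ Sᶜ, v j
    · exact ⟨S, by omega, hp, Or.inl hS⟩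
    have h := h.resolve_left hS
    push Not at hS
    -- Removing a violating `i` costs the remainder more than a `τ` fraction; strictness also makes
    -- `v i` positive.
    obtain ⟨i, hi, hvi⟩ := hS
    have hR : 0 ≤ ∑ j ∈ Sᶜ, v j := Finset.sum_nonneg fun j _ => hv j
    refine ⟨insert i S, (Finset.card_insert_le _ _).trans (by omega), ?_, Or.inr ?_⟩
    · intro j hj
      rcases Finset.mem_insert.1 hj with rfl | hj
      · exact lt_of_le_of_lt (by positivity) hvi
      · exact hp j hj
    · have he := Finset.add_sum_erase Sᶜ v (Finset.mem_compl.2 hi)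
      rw [Finset.compl_insert, pow_succ]
      have : (1 - τ) * ∑ j ∈ Sᶜ, v j ≤ (1 - τ) * ((1 - τ) ^ K * ∑ j, v j) :=
        mul_le_mul_of_nonneg_left h (by linarith)
      linarith

lemma isRegular_of_sum_influence_nonpos {Q : MultilinearPoly n} (h : ∑ i, Q.influence i ≤ 0)
    (t : ℝ) : Q.IsRegular t := by
  have h0 : ∑ i, Q.influence i = 0 :=
    le_antisymm h (Finset.sum_nonneg fun i _ => Q.influence_nonneg i)
  intro i
  rw [h0, mul_zero]
  exact ((Finset.sum_eq_zero_iff_of_nonneg fun i _ => Q.influence_nonneg i).1 h0 i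
    (Finset.mem_univ i)).le

/-- The margin over `1` lets a fixed power of the logarithm absorb absolute constants in
`tight_exponent_bound`. -/
lemma one_lt_log_inv {τ : ℝ} (hτ : 0 < τ) (hτ1 : τ < 1 / 3) : 1.05 < Real.log (1 / τ) := by
  rw [Real.lt_log_iff_exp_lt (by positivity), lt_div_iff₀ hτ]
  have h1 := Real.exp_one_lt_d9
  have h2 : Real.exp 0.05 ≤ 20 / 19 := by
    have h3 := Real.add_one_le_exp (-0.05)
    rw [Real.exp_neg] at h3
    rw [← inv_inv (Real.exp 0.05)]
    refine (inv_anti₀ (by norm_num) h3).trans ?_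
    norm_num
  have h3 : Real.exp 1.05 ≤ 2.9 := by
    rw [show (1.05 : ℝ) = 1 + 0.05 by norm_num, Real.exp_add]
    calc _ ≤ 2.7182818286 * (20 / 19 : ℝ) := by gcongr
      _ ≤ _ := by norm_num
  nlinarith

/-- The arithmetic of the union bound: with `p = ⌈log(1/τ)⌉`, `3^{-p} ≤ τ` cancels the `1/τ` and
`72^{-d}` supplies the rest. -/
lemma regular_moment_bound {d : ℕ} (hd : 1 ≤ d) {τ : ℝ} (hτ : 0 < τ) (hτ1 : τ < 1 / 3) :
    0 < tauPrime 4000 d τ ∧ ∃ p : ℕ, p ≠ 0 ∧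
      (2 * (2 * p - 1 : ℝ) ^ d * τ / tauPrime 4000 d τ) ^ p / τ ≤ 1 / (8 * 9 ^ d) := by
  set L := Real.log (1 / τ) with hL
  have hL1 : 1.05 < L := one_lt_log_inv hτ hτ1
  have hd1 : (1 : ℝ) ≤ d := by exact_mod_cast hd
  have hlog : 0.69 ≤ Real.log (max (d : ℝ) 2) := by
    have h1 := Real.log_two_gt_d9
    have h2 : Real.log 2 ≤ Real.log (max (d : ℝ) 2) :=
      Real.log_le_log (by norm_num) (le_max_right _ _)
    linarith
  -- Of the factor `d log(max(d,2))` only the lower bound `0.69` is used.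
  have hbase : 2000 * L ≤ 4000 * (d : ℝ) * Real.log (max (d : ℝ) 2) * L := by
    gcongr
    nlinarith
  have ht : (2000 * L) ^ d * τ ≤ tauPrime 4000 d τ := by
    unfold tauPrime
    gcongr
  have htp : 0 < tauPrime 4000 d τ := lt_of_lt_of_le (by positivity) ht
  set p := ⌈L⌉₊ with hp
  have hp0 : p ≠ 0 := (Nat.ceil_pos.2 (by linarith)).ne'
  have hpL : L ≤ p := Nat.le_ceil _
  have hpL2 : (p : ℝ) ≤ 2 * L := by
    have := Nat.ceil_lt_add_one (show 0 ≤ L by linarith)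
    linarith
  have h1p : (0 : ℝ) ≤ 2 * p - 1 := by linarith
  refine ⟨htp, p, hp0, ?_⟩
  have hq : 2 * (2 * p - 1 : ℝ) ^ d * τ / tauPrime 4000 d τ ≤ 1 / 3 * (1 / 72) ^ d := by
    calc _ ≤ 2 * (4 * L) ^ d * τ / ((2000 * L) ^ d * τ) := by
          have : (2 * p - 1 : ℝ) ^ d ≤ (4 * L) ^ d := pow_le_pow_left₀ h1p (by linarith) _
          gcongr
      _ = 2 * (1 / 500) ^ d := by
          rw [mul_pow, mul_pow, div_pow, show (2000 : ℝ) = 4 * 500 by norm_num, mul_pow]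
          field_simp
          simp
      _ = 2 * ((72 / 500) ^ d * (1 / 72) ^ d) := by rw [← mul_pow]; norm_num
      _ ≤ 2 * ((72 / 500) ^ 1 * (1 / 72) ^ d) := by
          have : (72 / 500 : ℝ) ^ d ≤ (72 / 500) ^ 1 :=
            pow_le_pow_of_le_one (by norm_num) (by norm_num) hd
          gcongr
      _ ≤ _ := by
          have : (0 : ℝ) ≤ (1 / 72) ^ d := by positivity
          nlinarith
  have h3 : (1 / 3 : ℝ) ^ p ≤ τ := by
    calc _ ≤ Real.exp (-1) ^ p := by
          refine pow_le_pow_left₀ (by norm_num) ?_ _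
          rw [Real.exp_neg, ← one_div]
          have := Real.exp_one_lt_d9
          exact one_div_le_one_div_of_le (Real.exp_pos _) (by linarith)
      _ = Real.exp (-p) := by rw [← Real.exp_nat_mul]; ring_nf
      _ ≤ Real.exp (-L) := Real.exp_le_exp.2 (by linarith)
      _ = τ := by rw [hL, ← Real.log_inv, Real.exp_log (by positivity)]; simp
  rw [div_le_iff₀ hτ]
  calc _ ≤ (1 / 3 * (1 / 72) ^ d : ℝ) ^ p := by
        refine pow_le_pow_left₀ ?_ hq _
        exact div_nonneg (mul_nonneg (mul_nonneg two_pos.le (pow_nonneg h1p _)) hτ.le) htp.le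
    _ = (1 / 3 : ℝ) ^ p * ((1 / 72) ^ d) ^ p := mul_pow _ _ _
    _ ≤ τ * ((1 / 72) ^ d) ^ 1 := by
        have h4 : ((1 / 72 : ℝ) ^ d) ^ p ≤ ((1 / 72) ^ d) ^ 1 :=
          pow_le_pow_of_le_one (by positivity) (pow_le_one₀ (by norm_num) (by norm_num))
            (Nat.one_le_iff_ne_zero.2 hp0)
        gcongr
    _ ≤ 1 / (8 * 9 ^ d) * τ := by
        rw [pow_one, mul_comm]
        refine mul_le_mul_of_nonneg_right ?_ hτ.le
        rw [one_div_pow]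
        refine one_div_le_one_div_of_le (by positivity) ?_
        calc (8 * 9 ^ d : ℝ) ≤ 8 ^ d * 9 ^ d := by
              gcongr
              exact le_self_pow₀ (by norm_num) (by omega)
          _ = 72 ^ d := by rw [← mul_pow]; norm_num

/-- If the influences outside `S` are balanced, a random restriction is regular with
probability bounded below. -/
lemma le_cubeProb_isRegular {P : MultilinearPoly n} {d : ℕ} (hd : 1 ≤ d) (hP : P.HasDegree d)
    {τ : ℝ} (hτ : 0 < τ) (hτ1 : τ < 1 / 3) {S : Finset (Fin n)}
    (hS : ∀ i ∉ S, P.influence i ≤ τ * ∑ j ∈ Sᶜ, P.influence j) :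
    1 / (8 * 9 ^ d) ≤ cubeProb (fun ξ => (P.restrict S ξ).IsRegular (tauPrime 4000 d τ)) := by
  set m := ∑ j ∈ Sᶜ, P.influence j with hm
  have hE := cubeExp_sum_restrict_influence P S
  rcases (Finset.sum_nonneg fun j _ => P.influence_nonneg j : 0 ≤ m).eq_or_lt with h0 | h0
  · have hall : ∀ ξ, (P.restrict S ξ).IsRegular (tauPrime 4000 d τ) := fun ξ =>
      isRegular_of_sum_influence_nonpos (eq_zero_of_cubeExp_nonpos
        (f := fun ξ => ∑ i, (P.restrict S ξ).influence i)
        (fun ξ => Finset.sum_nonneg fun i _ => influence_nonneg _ i) (hE.trans h0.symm).le ξ).le _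
    simp only [hall, cubeProb_eq_cubeExp, if_true, cubeExp_const]
    rw [div_le_one (by positivity)]
    have : (1 : ℝ) ≤ 9 ^ d := one_le_pow₀ (by norm_num)
    linarith
  obtain ⟨ht, p, hp, hpb⟩ := regular_moment_bound hd hτ hτ1
  set t := tauPrime 4000 d τ
  have h1p : (0 : ℝ) ≤ 2 * p - 1 := by
    have : (1 : ℝ) ≤ p := by exact_mod_cast Nat.one_le_iff_ne_zero.2 hp
    linarith
  have hPZ := le_cubeProb_of_cubeExp_sq_le (f := fun ξ => ∑ i, (P.restrict S ξ).influence i)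
    (B := 9 ^ d) (m := m) h0 (by positivity) hE.ge (cubeExp_sum_restrict_influence_sq_le hP S)
  have hm0 : m ≠ 0 := h0.ne'
  have hl : 0 < t * (m / 2) := by positivity
  have hU : cubeProb (fun ξ => ∃ i ∈ Sᶜ, t * (m / 2) < (P.restrict S ξ).influence i) ≤
      1 / (8 * 9 ^ d) := by
    refine (cubeProb_exists_le _ _).trans (le_trans ?_ hpb)
    calc _ ≤ ∑ i ∈ Sᶜ, ((2 * p - 1) ^ d * P.influence i) ^ p / (t * (m / 2)) ^ p := by
          refine Finset.sum_le_sum fun i hi => ?_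
          refine cubeProb_le_of_cubeExp_le (f := fun ξ => (P.restrict S ξ).influence i ^ p)
            (fun ξ => pow_nonneg (influence_nonneg _ i) _)
            (fun ξ hξ => pow_le_pow_left₀ hl.le hξ.le _) (by positivity)
            (cubeExp_restrict_influence_pow_le hP (Finset.mem_compl.1 hi) hp)
      _ ≤ ∑ i ∈ Sᶜ, ((2 * p - 1) ^ d) ^ p * (τ * m) ^ (p - 1) / (t * (m / 2)) ^ p *
            P.influence i := by
          refine Finset.sum_le_sum fun i hi => ?_
          -- Balance is spent on `p - 1` of the factors; the last one is kept so that the sum over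
          -- `i` gives `m`.
          have h2 : P.influence i ^ p ≤ (τ * m) ^ (p - 1) * P.influence i := by
            obtain ⟨q, rfl⟩ := Nat.exists_eq_succ_of_ne_zero hp
            rw [pow_succ]
            exact mul_le_mul_of_nonneg_right (pow_le_pow_left₀ (influence_nonneg _ i)
              (hS i (Finset.mem_compl.1 hi)) _) (influence_nonneg _ i)
          rw [mul_pow, div_mul_eq_mul_div, mul_assoc]
          refine div_le_div_of_nonneg_right ?_ (by positivity)
          exact mul_le_mul_of_nonneg_left h2 (pow_nonneg (pow_nonneg h1p _) _)
      _ = (2 * (2 * p - 1 : ℝ) ^ d * τ / t) ^ p / τ := by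
          rw [← Finset.mul_sum, ← hm]
          obtain ⟨q, rfl⟩ := Nat.exists_eq_succ_of_ne_zero hp
          clear_value m
          generalize (2 * ((q.succ : ℕ) : ℝ) - 1) ^ d = A
          simp only [Nat.succ_eq_add_one, Nat.add_sub_cancel, mul_pow, div_pow, pow_succ]
          field_simp
  have heq : (1 : ℝ) / (8 * 9 ^ d) = 1 / (4 * 9 ^ d) - 1 / (8 * 9 ^ d) := by
    field_simp
    norm_num
  rw [heq]
  refine sub_le_cubeProb hPZ hU fun ξ h1 h2 => ?_
  push Not at h2
  intro i
  have h3 : t * (m / 2) ≤ t * ∑ i, (P.restrict S ξ).influence i := by gcongr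
  by_cases hi : i ∈ S
  · rw [restrict_influence_of_mem P ξ hi]
    linarith
  · exact (h2 i (Finset.mem_compl.2 hi)).trans h3

/-- If the influences outside `S` are small in total, a random restriction is tight with
probability bounded below. -/
lemma le_cubeProb_isTight {P : MultilinearPoly n} {d : ℕ} (hd : 1 ≤ d) (hP : P.HasDegree d)
    {C β δ : ℝ} (hC : 100 ≤ C) (hβ : 0 < β) (hβ1 : β < 1 / 3) (hδ : 0 < δ)
    (hδ1 : 32 * 9 ^ d * d * (C * Real.log (1 / β)) ^ d * δ ≤ 1)
    (h0 : 0 < ∑ i, P.influence i) {S : Finset (Fin n)}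
    (hS : ∑ j ∈ Sᶜ, P.influence j ≤ δ * ∑ i, P.influence i) :
    1 / (8 * 9 ^ d) ≤ cubeProb (fun ξ => (P.restrict S ξ).IsTight d C β) := by
  set V := P.coeffVar with hV
  set l := Real.log (1 / β) with hl
  have hl1 : 1.05 < l := one_lt_log_inv hβ hβ1
  have hCl : 1 ≤ (C * l) ^ d := one_le_pow₀ (by nlinarith)
  have hd1 : (1 : ℝ) ≤ d := by exact_mod_cast hd
  have hdV := hP.sum_influence_le
  have hVpos : 0 < V := by
    by_contra! hc
    nlinarith
  have hR : ∑ j ∈ Sᶜ, P.influence j ≤ δ * d * V := by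
    rw [mul_assoc]
    exact hS.trans (mul_le_mul_of_nonneg_left hdV hδ.le)
  have h9 : (1 : ℝ) ≤ 9 ^ d := one_le_pow₀ (by norm_num)
  have hδd : δ * d ≤ 1 / 2 := by
    have : δ * d * (1 * 1) ≤ δ * d * (9 ^ d * (C * l) ^ d) := by gcongr
    linarith
  have hX : cubeExp (fun ξ => (P.restrict S ξ).coeffVar) ≤ δ * d * V :=
    (cubeExp_mono fun ξ => coeffVar_le_sum_influence _).trans
      ((cubeExp_sum_restrict_influence P S).trans_le hR)
  -- Restriction preserves the mean sum of squared coefficients, so variance lost by `q_ρ` reappears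
  -- in `P*(ρ)²`.
  have hsum : cubeExp (fun ξ => (P.restrict S ξ).constTerm ^ 2) +
      cubeExp (fun ξ => (P.restrict S ξ).coeffVar) = P.constTerm ^ 2 + V := by
    rw [← cubeExp_add]
    simp only [constTerm_sq_add_coeffVar]
    rw [cubeExp_sum]
    simp only [cubeExp_restrict_coeff_sq]
    rw [sum_coeffWeight, hV, constTerm_sq_add_coeffVar]
  set m := cubeExp (fun ξ => (P.restrict S ξ).constTerm ^ 2) with hm
  have hmV : V / 2 ≤ m := by nlinarith [sq_nonneg P.constTerm]
  have hm2 : cubeExp (fun ξ => ((P.restrict S ξ).constTerm ^ 2) ^ 2) ≤ 9 ^ d * m ^ 2 := by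
    refine (cubeExp_restrict_coeff_pow_le hP S ∅ two_ne_zero).trans_eq ?_
    rw [hm]
    unfold constTerm
    rw [cubeExp_restrict_coeff_sq, mul_pow, ← pow_mul, mul_comm d, pow_mul]
    norm_num
  have hPZ := le_cubeProb_of_cubeExp_sq_le (f := fun ξ => (P.restrict S ξ).constTerm ^ 2)
    (B := 9 ^ d) (m := m) (by linarith) (by positivity) le_rfl hm2
  have hMk := cubeProb_le_of_cubeExp_le
    (A := fun ξ => 8 * 9 ^ d * (δ * d * V) ≤ (P.restrict S ξ).coeffVar)
    (l := 8 * 9 ^ d * (δ * d * V)) (fun ξ => coeffVar_nonneg _) (fun ξ h => h) (by positivity) hX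
  have hMk' : δ * d * V / (8 * 9 ^ d * (δ * d * V)) = 1 / (8 * 9 ^ d) := by
    field_simp
  rw [hMk'] at hMk
  have heq : (1 : ℝ) / (8 * 9 ^ d) = 1 / (4 * 9 ^ d) - 1 / (8 * 9 ^ d) := by
    field_simp
    norm_num
  rw [heq]
  refine sub_le_cubeProb hPZ hMk fun ξ h1 h2 => ?_
  rw [not_le] at h2
  refine isTight_of_coeffVar_le hd (hP.restrict S ξ) hC hβ hβ1 ?_ ?_
  · intro hc
    rw [hc] at h1
    linarith
  · rw [← hl]
    -- The `32` in `hδ1` is `8` from the Markov threshold times `4` from `P*(ρ)² ≥ m/2 ≥ V/4`.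
    calc _ ≤ 8 * 9 ^ d * (δ * d * V) * (C * l) ^ d := by gcongr
      _ = (32 * 9 ^ d * d * (C * l) ^ d * δ) * (V / 4) := by ring
      _ ≤ 1 * (V / 4) := by gcongr
      _ ≤ _ := by linarith

/-- The term `d log log(1/β)` of the exponent suffices: it gives `l^(1000d)`, and per degree the
constant `64·9·2·1000 = 1152000` is below `1.05^300`. The `64` is the `32` of `le_cubeProb_isTight`
doubled by `δ = 2e^{-α}`. -/
lemma tight_exponent_bound {d : ℕ} (hd : 1 ≤ d) {β : ℝ} (hβ : 0 < β) (hβ1 : β < 1 / 3) :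
    64 * 9 ^ d * d * (1000 * Real.log (1 / β)) ^ d ≤ Real.exp (treeAlpha 1000 d β) := by
  set l := Real.log (1 / β) with hl
  have hl1 : 1.05 < l := one_lt_log_inv hβ hβ1
  have hd1 : (1 : ℝ) ≤ d := by exact_mod_cast hd
  have hpow : 1152000 * l ≤ l ^ 1000 := by
    have h1 : (1152000 : ℝ) ≤ l ^ 300 :=
      calc (1152000 : ℝ) ≤ (1.05 ^ 100) ^ 3 := by norm_num
        _ ≤ (l ^ 100) ^ 3 := by gcongr
        _ = l ^ 300 := (pow_mul l 100 3).symm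
    calc 1152000 * l ≤ l ^ 300 * l := by gcongr
      _ = l ^ 301 := (pow_succ _ _).symm
      _ ≤ l ^ 1000 := pow_le_pow_right₀ (by linarith) (by norm_num)
  have h2d : (d : ℝ) ≤ 2 ^ d := by exact_mod_cast Nat.lt_two_pow_self.le
  calc 64 * 9 ^ d * d * (1000 * l) ^ d ≤ 64 ^ d * 9 ^ d * 2 ^ d * (1000 * l) ^ d := by
        gcongr
        exact le_self_pow₀ (by norm_num) (by omega)
    _ = (1152000 * l) ^ d := by
        rw [← mul_pow, ← mul_pow, ← mul_pow]
        ring_nf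
    _ ≤ (l ^ 1000) ^ d := by gcongr
    _ = Real.exp (1000 * (d * Real.log l)) := by
        rw [← pow_mul, ← Real.exp_log (show 0 < l ^ (1000 * d) by positivity), Real.log_pow]
        push_cast
        ring_nf
    _ ≤ _ := by
        refine Real.exp_le_exp.2 ?_
        unfold treeAlpha
        have := Real.log_nonneg hd1
        gcongr
        exact le_add_of_nonneg_right (by positivity)

/-- One round: restricting a suitable set of at most `α / τ` variables succeeds with probability
bounded below. -/
lemma exists_restriction_set {P : MultilinearPoly n} {d : ℕ} (hd : 1 ≤ d) (hP : P.HasDegree d)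
    {τ β : ℝ} (hτ : 0 < τ) (hτ1 : τ < 1 / 3) (hβ : 0 < β) (hβ1 : β < 1 / 3) :
    ∃ S : Finset (Fin n), S.card ≤ ⌊treeAlpha 1000 d β / τ⌋₊ ∧ (∀ i ∈ S, 0 < P.influence i) ∧
      1 / (8 * 9 ^ d) ≤ cubeProb (fun ξ => (P.restrict S ξ).IsRegular (tauPrime 4000 d τ) ∨
        (P.restrict S ξ).IsTight d 1000 β) := by
  set K := ⌊treeAlpha 1000 d β / τ⌋₊ with hK
  rcases (Finset.sum_nonneg fun i _ => P.influence_nonneg i :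
    0 ≤ ∑ i, P.influence i).eq_or_lt with h0 | h0
  · refine ⟨∅, by simp, by simp, (le_cubeProb_isRegular hd hP hτ hτ1 fun i _ => ?_).trans
      (cubeProb_mono fun ξ h => Or.inl h)⟩
    have := (Finset.sum_eq_zero_iff_of_nonneg fun i _ => P.influence_nonneg i).1 h0.symm i
      (Finset.mem_univ i)
    rw [Finset.compl_empty, ← h0, mul_zero, this]
  obtain ⟨S, hc, hp, h | h⟩ := exists_greedy_set P.influence P.influence_nonneg hτ (by linarith) K
  · exact ⟨S, hc, hp, (le_cubeProb_isRegular hd hP hτ hτ1 h).trans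
      (cubeProb_mono fun ξ h => Or.inl h)⟩
  refine ⟨S, hc, hp, (le_cubeProb_isTight (C := 1000) (δ := 2 * Real.exp (-treeAlpha 1000 d β))
    hd hP (by norm_num) hβ hβ1 (by positivity) ?_ h0 (h.trans ?_)).trans
      (cubeProb_mono fun ξ h => Or.inr h)⟩
  · rw [Real.exp_neg]
    have h1 := tight_exponent_bound hd hβ hβ1
    have h2 : 0 < Real.exp (treeAlpha 1000 d β) := Real.exp_pos _
    rw [← mul_assoc, ← div_eq_mul_inv, div_le_one h2]
    linarith
  · refine mul_le_mul_of_nonneg_right ?_ h0.le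
    have h1 : 1 - τ ≤ Real.exp (-τ) := by
      have := Real.add_one_le_exp (-τ)
      linarith
    -- Rounding `K` down loses at most `τ < 1/3` in the exponent; the `2` in `δ` covers `e^{1/3}`.
    have hK1 : treeAlpha 1000 d β ≤ τ * (K + 1) := by
      have := (Nat.lt_floor_add_one (treeAlpha 1000 d β / τ)).le
      rw [div_le_iff₀ hτ] at this
      linarith
    calc (1 - τ) ^ K ≤ Real.exp (-τ) ^ K := pow_le_pow_left₀ (by linarith) h1 _
      _ = Real.exp (-(τ * K)) := by rw [← Real.exp_nat_mul]; ring_nf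
      _ ≤ Real.exp (1 / 3 + -treeAlpha 1000 d β) := Real.exp_le_exp.2 (by linarith)
      _ ≤ 2 * Real.exp (-treeAlpha 1000 d β) := by
          rw [Real.exp_add]
          gcongr
          rw [← Real.le_log_iff_exp_le (by norm_num)]
          have := Real.log_two_gt_d9
          linarith

end MultilinearPoly

/-! ### The decision tree -/

namespace DecisionTree

variable {n : ℕ}

lemma queried_subset_vars (T : DecisionTree n) (ξ : Cube n) : T.queried ξ ⊆ T.vars := by
  induction T with
  | leaf => exact Finset.empty_subset _
  | node i neg pos ihn ihp =>
    refine Finset.insert_subset_insert i ?_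
    split_ifs
    · exact ihp.trans Finset.subset_union_right
    · exact ihn.trans Finset.subset_union_left

lemma queried_congr (T : DecisionTree n) {ξ ξ' : Cube n} (h : ∀ j ∈ T.vars, ξ j = ξ' j) :
    T.queried ξ = T.queried ξ' := by
  induction T with
  | leaf => rfl
  | node i neg pos ihn ihp =>
    simp only [vars, Finset.mem_insert, Finset.mem_union] at h
    rw [queried, queried, ihn fun j hj => h j (by tauto), ihp fun j hj => h j (by tauto),
      h i (by tauto)]

lemma leafPoly_congr (T : DecisionTree n) (P : MultilinearPoly n) {ξ ξ' : Cube n}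
    (h : ∀ j ∈ T.vars, ξ j = ξ' j) : T.leafPoly P ξ = T.leafPoly P ξ' := by
  unfold leafPoly
  rw [T.queried_congr h]
  refine P.restrict_congr fun j hj => h j (T.queried_subset_vars _ hj)

lemma leafPoly_flipAt (T : DecisionTree n) (P : MultilinearPoly n) {i : Fin n} (hi : i ∉ T.vars)
    (ξ : Cube n) : T.leafPoly P (flipAt i ξ) = T.leafPoly P ξ :=
  T.leafPoly_congr P fun _ hj => flipAt_of_ne (ne_of_mem_of_not_mem hj hi) ξ

/-- Restrictions compose, so a subtree may be run on the restricted root polynomial. This makes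
induction over trees possible. -/
lemma leafPoly_node {i : Fin n} {neg pos : DecisionTree n} (hn : i ∉ neg.vars)
    (hp : i ∉ pos.vars) (P : MultilinearPoly n) (ξ : Cube n) :
    (node i neg pos).leafPoly P ξ = if ξ i = 1 then pos.leafPoly (P.restrict {i} fun _ => 1) ξ
      else neg.leafPoly (P.restrict {i} fun _ => -1) ξ := by
  unfold leafPoly
  rw [queried]
  split_ifs with h
  · rw [P.restrict_insert (fun hi => hp (pos.queried_subset_vars ξ hi))]
    congr 1
    exact P.restrict_congr fun j hj => by rw [Finset.mem_singleton.1 hj, h]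
  · rw [P.restrict_insert (fun hi => hn (neg.queried_subset_vars ξ hi))]
    congr 1
    exact P.restrict_congr fun j hj => by
      rw [Finset.mem_singleton.1 hj, (Int.units_eq_one_or (ξ i)).resolve_left h]

lemma cubeProb_leafPoly_node {i : Fin n} {neg pos : DecisionTree n} (hn : i ∉ neg.vars)
    (hp : i ∉ pos.vars) (P : MultilinearPoly n) (B : MultilinearPoly n → Prop) :
    cubeProb (fun ξ => B ((node i neg pos).leafPoly P ξ)) =
      (cubeProb (fun ξ => B (pos.leafPoly (P.restrict {i} fun _ => 1) ξ)) +
        cubeProb (fun ξ => B (neg.leafPoly (P.restrict {i} fun _ => -1) ξ))) / 2 := by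
  rw [← cubeProb_ite i]
  · congr 1
    ext ξ
    rw [leafPoly_node hn hp]
    split_ifs <;> rfl
  · intro ξ
    rw [leafPoly_flipAt _ _ hp]
  · intro ξ
    rw [leafPoly_flipAt _ _ hn]

lemma cubeProb_restrict_insert {i : Fin n} {S : Finset (Fin n)} (hi : i ∉ S)
    (P : MultilinearPoly n) (B : MultilinearPoly n → Prop) :
    cubeProb (fun ξ => B (P.restrict (insert i S) ξ)) =
      (cubeProb (fun ξ => B ((P.restrict {i} fun _ => 1).restrict S ξ)) +
        cubeProb (fun ξ => B ((P.restrict {i} fun _ => -1).restrict S ξ))) / 2 := by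
  have hflip : ∀ (Q : MultilinearPoly n) ξ, Q.restrict S (flipAt i ξ) = Q.restrict S ξ :=
    fun Q ξ => Q.restrict_congr fun j hj => flipAt_of_ne (ne_of_mem_of_not_mem hj hi) ξ
  rw [← cubeProb_ite i]
  · congr 1
    ext ξ
    rw [P.restrict_insert hi]
    split_ifs with h
    · rw [P.restrict_congr (ξ' := fun _ => 1) fun j hj => by rw [Finset.mem_singleton.1 hj, h]]
    · rw [P.restrict_congr (ξ' := fun _ => -1) fun j hj => by
        rw [Finset.mem_singleton.1 hj, (Int.units_eq_one_or (ξ i)).resolve_left h]]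
  · intro ξ
    rw [hflip]
  · intro ξ
    rw [hflip]

open Classical in
/-- Querying all variables of `S` first, and continuing with given trees. -/
lemma exists_tree_extending {d N : ℕ} {r : ℝ} (B : MultilinearPoly n → Prop)
    (cont : ∀ Q : MultilinearPoly n, Q.HasDegree d → ∃ T : DecisionTree n, T.NoRepeat ∧
      (∀ j ∈ T.vars, 0 < Q.influence j) ∧ T.depth ≤ N ∧
      cubeProb (fun ξ => B (T.leafPoly Q ξ)) ≤ r * if B Q then 1 else 0)
    (S : Finset (Fin n)) (P : MultilinearPoly n) (hP : P.HasDegree d) :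
    ∃ T : DecisionTree n, T.NoRepeat ∧ (∀ j ∈ T.vars, j ∈ S ∨ 0 < P.influence j) ∧
      T.depth ≤ N + S.card ∧
      cubeProb (fun ξ => B (T.leafPoly P ξ)) ≤ r * cubeProb (fun ξ => B (P.restrict S ξ)) := by
  induction S using Finset.induction_on generalizing P with
  | empty =>
    obtain ⟨T, h1, h2, h3, h4⟩ := cont P hP
    refine ⟨T, h1, fun j hj => Or.inr (h2 j hj), by simpa using h3, h4.trans_eq ?_⟩
    simp only [MultilinearPoly.restrict_empty]
    rw [cubeProb_eq_cubeExp, cubeExp_const]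
  | insert i S hi ih =>
    obtain ⟨pos, p1, p2, p3, p4⟩ := ih (P.restrict {i} fun _ => 1) (hP.restrict _ _)
    obtain ⟨neg, n1, n2, n3, n4⟩ := ih (P.restrict {i} fun _ => -1) (hP.restrict _ _)
    -- Subtrees query only variables in `S` or of positive influence; `i` is now neither.
    have hdead : ∀ ρ : Cube n, (P.restrict {i} ρ).influence i = 0 := fun ρ =>
      P.restrict_influence_of_mem ρ (Finset.mem_singleton_self i)
    have hpi : i ∉ pos.vars := fun h => by
      rcases p2 i h with h | h
      · exact hi h
      · exact h.ne' (hdead _)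
    have hni : i ∉ neg.vars := fun h => by
      rcases n2 i h with h | h
      · exact hi h
      · exact h.ne' (hdead _)
    refine ⟨node i neg pos, ⟨hni, hpi, n1, p1⟩, ?_, ?_, ?_⟩
    · intro j hj
      simp only [vars, Finset.mem_insert, Finset.mem_union] at hj ⊢
      rcases hj with hj | hj | hj
      · exact Or.inl (Or.inl hj)
      · exact (n2 j hj).imp Or.inr MultilinearPoly.influence_pos_of_restrict
      · exact (p2 j hj).imp Or.inr MultilinearPoly.influence_pos_of_restrict
    · rw [Finset.card_insert_of_notMem hi]
      simp only [depth]
      omega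
    · rw [cubeProb_leafPoly_node hni hpi, cubeProb_restrict_insert hi]
      linarith

/-- Iterating rounds: if one round of at most `K` queries fails with probability at most `r`, then
`M` rounds fail with probability at most `r ^ M`. -/
lemma exists_tree_of_rounds {d K : ℕ} {r : ℝ} (hr : 0 ≤ r) (B : MultilinearPoly n → Prop)
    (round : ∀ Q : MultilinearPoly n, Q.HasDegree d → ∃ S : Finset (Fin n), S.card ≤ K ∧
      (∀ j ∈ S, 0 < Q.influence j) ∧ cubeProb (fun ξ => B (Q.restrict S ξ)) ≤ r) (M : ℕ)
    (P : MultilinearPoly n) (hP : P.HasDegree d) :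
    ∃ T : DecisionTree n, T.NoRepeat ∧ (∀ j ∈ T.vars, 0 < P.influence j) ∧ T.depth ≤ M * K ∧
      cubeProb (fun ξ => B (T.leafPoly P ξ)) ≤ r ^ M := by
  classical
  have hleaf : ∀ (Q : MultilinearPoly n) (ξ : Cube n), (leaf : DecisionTree n).leafPoly Q ξ = Q :=
    fun Q ξ => Q.restrict_empty ξ
  induction M generalizing P with
  | zero =>
    exact ⟨leaf, trivial, fun j hj => absurd hj (Finset.notMem_empty j), by simp [depth],
      by simpa using cubeProb_le_one _⟩
  | succ M ih =>
    obtain ⟨S, hc, hp, hS⟩ := round P hP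
    obtain ⟨T, h1, h2, h3, h4⟩ := exists_tree_extending (d := d) (N := M * K) (r := r ^ M) B
      (fun Q hQ => by
        -- Only leaves where the round failed are extended, which gives the product of failure
        -- probabilities.
        by_cases hB : B Q
        · obtain ⟨T, h1, h2, h3, h4⟩ := ih Q hQ
          exact ⟨T, h1, h2, h3, by simpa [hB] using h4⟩
        · refine ⟨leaf, trivial, fun j hj => absurd hj (Finset.notMem_empty j), by simp [depth], ?_⟩
          simp [hleaf, hB, cubeProb_eq_cubeExp, cubeExp_const]) S P hP
    refine ⟨T, h1, fun j hj => (h2 j hj).elim (hp j) id, ?_, ?_⟩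
    · rw [Nat.succ_mul]
      omega
    · rw [pow_succ]
      exact h4.trans (mul_le_mul_of_nonneg_left hS (pow_nonneg hr _))

end DecisionTree

theorem mainTheorem7 :
    ∃ C C' : ℝ, 1 ≤ C ∧ 0 < C' ∧
      ∀ (n d : ℕ), 1 ≤ d →
      ∀ (P : MultilinearPoly n), P.HasDegree d →
      ∀ (τ β : ℝ), 0 < τ → τ < 1 / 3 → 0 < β → β < 1 / 3 →
      ∀ (M : ℕ), (M : ℝ) * (treeAlpha C d β / τ) ≤ (n : ℝ) →
        ∃ T : DecisionTree n,
          T.NoRepeat ∧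
          (T.depth : ℝ) ≤ (M : ℝ) * (treeAlpha C d β / τ) ∧
          (∀ ξ : Cube n, (T.leafPoly P ξ).HasDegree d) ∧
          1 - (1 - 1 / (2 * C ^ d)) ^ M ≤
            cubeProb (fun ξ : Cube n =>
              (T.leafPoly P ξ).IsRegular (tauPrime C' d τ) ∨
                (T.leafPoly P ξ).IsTight d C β) := by
  refine ⟨1000, 4000, by norm_num, by norm_num, ?_⟩
  intro n d hd P hP τ β hτ hτ1 hβ hβ1 M _
  have hpow : (1 : ℝ) / (2 * 1000 ^ d) ≤ 1 / (8 * 9 ^ d) := by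
    refine one_div_le_one_div_of_le (by positivity) ?_
    have h1 : (8 : ℝ) ≤ 8 ^ d := le_self_pow₀ (by norm_num) (by omega)
    calc (8 * 9 ^ d : ℝ) ≤ 8 ^ d * 9 ^ d := by gcongr
      _ = 72 ^ d := by rw [← mul_pow]; norm_num
      _ ≤ 1000 ^ d := by gcongr; norm_num
      _ ≤ _ := by linarith [show (0 : ℝ) ≤ 1000 ^ d by positivity]
  have hr : (0 : ℝ) ≤ 1 - 1 / (2 * 1000 ^ d) := by
    rw [sub_nonneg, div_le_one (by positivity)]
    linarith [show (1 : ℝ) ≤ 1000 ^ d from one_le_pow₀ (by norm_num)]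
  -- `Nat.floor_le` needs this sign; `log log(1/β) ≥ 0` because `β < 1/3 < 1/e`.
  have hα : 0 ≤ treeAlpha 1000 d β / τ := by
    refine div_nonneg ?_ hτ.le
    have h1 := Real.log_nonneg
      (show 1 ≤ Real.log (1 / β) by linarith [MultilinearPoly.one_lt_log_inv hβ hβ1])
    have h2 := Real.log_nonneg (show (1 : ℝ) ≤ d by exact_mod_cast hd)
    unfold treeAlpha
    positivity
  obtain ⟨T, h1, -, h3, h4⟩ := DecisionTree.exists_tree_of_rounds (d := d)
    (K := ⌊treeAlpha 1000 d β / τ⌋₊) hr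
    (fun Q : MultilinearPoly n => ¬ (Q.IsRegular (tauPrime 4000 d τ) ∨ Q.IsTight d 1000 β))
    (fun Q hQ => by
      obtain ⟨S, hc, hp, h⟩ := MultilinearPoly.exists_restriction_set hd hQ hτ hτ1 hβ hβ1
      refine ⟨S, hc, hp, ?_⟩
      rw [cubeProb_not]
      linarith) M P hP
  refine ⟨T, h1, ?_, fun ξ => hP.restrict _ _, ?_⟩
  · calc (T.depth : ℝ) ≤ M * (⌊treeAlpha 1000 d β / τ⌋₊ : ℝ) := by exact_mod_cast h3
      _ ≤ _ := by
        gcongr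
        exact Nat.floor_le hα
  · rw [cubeProb_not] at h4
    linarith
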